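/- Let $h$ and $k$ be positive integers with $k\equiv 2 \pmod 4$ and $2\le h\le k/2$. Write $\sigma_s(m)=\sum_{d\mid m} d^s$ for the sum of the $s$-th powers of the positive divisors of $m$, and let $\zeta$ be the Riemann zeta function. Then $$\zeta(2h) = -\pi^h \sum_{m=1}^\infty \frac{\sigma_{1-2h}(m)}{m^{1-h}}\, e^{-2\pi m} \sum_{r=1-h}^{k/2} (-1)^r \binom{k/2-h}{k/2-r} \frac{(4\pi m)^{r}}{(h-1+r)!},$$ where the series over $m$ converges absolutely. -/

import Mathlib

/-- The divisor power function `σ_s(m) = ∑_{d ∣ m} d ^ s`, the sum running over the positive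
divisors `d` of `m`, for a complex exponent `s`. -/
noncomputable def divisorPowerSum (s : ℂ) (m : ℕ) : ℂ :=
  ∑ d ∈ m.divisors, (d : ℂ) ^ s

/-- The `m`-th term of the series:
`σ_{1-2h}(m) / m^{1-h} · e^{-2πm} · ∑_{r=1-h}^{k/2} (-1)^r C(k/2-h, k/2-r) (4πm)^r / (h-1+r)!`.
The index `r` runs over integers, possibly negative. For `1 - h ≤ r ≤ k/2` the integers
`k/2 - r` and `h - 1 + r` are nonnegative, so that `Int.toNat` only changes their type; the same
holds for `k/2 - h` when `h ≤ k/2`, and `k / 2` is exact for even `k`. -/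
noncomputable def zetaSeriesTerm (h k m : ℕ) : ℂ :=
  divisorPowerSum (1 - 2 * (h : ℂ)) m / (m : ℂ) ^ (1 - (h : ℤ))
    * Complex.exp (-2 * (Real.pi : ℂ) * (m : ℂ))
    * ∑ r ∈ Finset.Icc (1 - (h : ℤ)) ((k / 2 : ℕ) : ℤ),
        (-1 : ℂ) ^ r * (Nat.choose (k / 2 - h) (((k / 2 : ℕ) : ℤ) - r).toNat : ℂ)
          * ((4 * (Real.pi : ℂ) * (m : ℂ)) ^ r / (Nat.factorial ((h : ℤ) - 1 + r).toNat : ℂ))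

/-! With `w = 2h` and `n = k/2 - h`, sum `(c z̄ + d)^n / (c z + d)^(w+n)` over pairs `(c, d)` at `z
= i`. Its weight `w + 2n = k` is 2 mod 4, so the symmetry `z ↦ -1/z`, which fixes `i`, forces the
sum to vanish (`tsum_raisedEisensteinTerm_eq_zero`). The row `c = 0` gives `2ζ(2h)`; the Lipschitz
formula turns the other rows into exponential series (`tsum_raisedEisensteinTerm_row`), whose double
sum is collected by `m = c * l`. Solving for `ζ(2h)` gives the formula. -/

/-! ### Double sums and divisor sums -/

/-- Absolute convergence of `∑ l ^ p * g (c * l)` over pairs of positive integers. -/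
lemma summable_prod_pow_mul_comp_mul (p : ℕ) {g : ℕ → ℂ}
    (hg : Summable fun m : ℕ+ => ((m : ℕ) : ℝ) ^ (p + 1) * ‖g m‖) :
    Summable fun x : ℕ+ × ℕ+ => ((x.2 : ℕ) : ℂ) ^ p * g (x.1 * x.2) := by
  rw [← sigmaAntidiagonalEquivProd.summable_iff]
  apply Summable.of_norm
  rw [summable_sigma_of_nonneg (fun a => by positivity)]
  refine ⟨fun n => (hasSum_fintype _).summable, ?_⟩
  refine Summable.of_nonneg_of_le (fun n => tsum_nonneg fun _ => norm_nonneg _) (fun n => ?_) hg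
  have key : ∀ x : (n : ℕ).divisorsAntidiagonal,
      ‖((fun x : ℕ+ × ℕ+ => ((x.2 : ℕ) : ℂ) ^ p * g (x.1 * x.2)) ∘ sigmaAntidiagonalEquivProd)
        ⟨n, x⟩‖ ≤ ((n : ℕ) : ℝ) ^ p * ‖g n‖ := by
    intro x
    have hx := (Nat.mem_divisorsAntidiagonal.mp x.2).1
    simp only [Function.comp_apply, sigmaAntidiagonalEquivProd, divisorsAntidiagonalFactors,
      Equiv.coe_fn_mk, PNat.mk_coe, hx, norm_mul, norm_pow, Complex.norm_natCast]
    gcongr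
    exact Nat.le_of_dvd n.pos ⟨x.1.1, by rw [mul_comm, hx]⟩
  rw [tsum_fintype]
  calc _ ≤ ∑ _x : (n : ℕ).divisorsAntidiagonal, ((n : ℕ) : ℝ) ^ p * ‖g n‖ :=
        Finset.sum_le_sum fun x _ => key x
    _ = ((n : ℕ).divisors.card : ℝ) * (((n : ℕ) : ℝ) ^ p * ‖g n‖) := by
        rw [Finset.sum_const, nsmul_eq_mul, Finset.card_univ, Fintype.card_coe,
          ← Nat.map_div_right_divisors, Finset.card_map]
    -- Bounding the number of divisors by `n` costs the extra power in `hg`.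
    _ ≤ ((n : ℕ) : ℝ) * (((n : ℕ) : ℝ) ^ p * ‖g n‖) := by
        gcongr
        exact Nat.card_divisors_le_self n
    _ = _ := by ring

/-- Collecting the pairs `(c, l)` with the same product `c * l`. -/
lemma hasSum_sum_divisors_pow_mul (p : ℕ) {g : ℕ → ℂ}
    (hg : Summable fun m : ℕ+ => ((m : ℕ) : ℝ) ^ (p + 1) * ‖g m‖) :
    HasSum (fun m : ℕ+ => (∑ d ∈ (m : ℕ).divisors, (d : ℂ) ^ p) * g m)
      (∑' c : ℕ+, ∑' l : ℕ+, ((l : ℕ) : ℂ) ^ p * g (c * l)) := by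
  have hs := summable_prod_pow_mul_comp_mul p hg
  rw [← hs.tsum_prod]
  have h := (sigmaAntidiagonalEquivProd.hasSum_iff.mpr hs.hasSum).sigma
    (fun n => hasSum_fintype _)
  refine h.congr_fun fun n => ?_
  have key : ∀ x : (n : ℕ).divisorsAntidiagonal,
      ((fun x : ℕ+ × ℕ+ => ((x.2 : ℕ) : ℂ) ^ p * g (x.1 * x.2)) ∘ sigmaAntidiagonalEquivProd)
        ⟨n, x⟩ = ((x.1.2 : ℕ) : ℂ) ^ p * g n := by
    intro x
    have hx := (Nat.mem_divisorsAntidiagonal.mp x.2).1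
    simp only [Function.comp_apply, sigmaAntidiagonalEquivProd, divisorsAntidiagonalFactors,
      Equiv.coe_fn_mk, PNat.mk_coe, hx]
  rw [Finset.sum_congr rfl fun x _ => key x, Finset.sum_mul, Finset.univ_eq_attach,
    (n : ℕ).divisorsAntidiagonal.sum_attach (fun x : ℕ × ℕ => ((x.2 : ℕ) : ℂ) ^ p * g n),
    ← Nat.map_div_left_divisors, Finset.sum_map]
  rfl

/-! ### The Eisenstein series at `i` -/

/-- The general term `(c z̄ + d) ^ n / (c z + d) ^ (w + n)` of a nonholomorphic Eisenstein series,
at `z = i`. -/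
noncomputable def raisedEisensteinTerm (w n : ℕ) (x : ℤ × ℤ) : ℂ :=
  ((x.2 : ℂ) - x.1 * Complex.I) ^ n / (x.1 * Complex.I + x.2) ^ (w + n)

/-- At `z = i` the bases of numerator and denominator are conjugate, so the term has norm `|ci +
d|^(-w)`, and `w > 2`. -/
lemma summable_raisedEisensteinTerm {w : ℕ} (hw : 3 ≤ w) (n : ℕ) :
    Summable (raisedEisensteinTerm w n) := by
  rw [← (finTwoArrowEquiv ℤ).summable_iff]
  refine EisensteinSeries.summable_of_isBigO_rpow_norm (a := w) (by exact_mod_cast hw) ?_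
  have h := (EisensteinSeries.isBigO_linear_add_const_vec UpperHalfPlane.I 0 0).norm_left.pow w
  refine Asymptotics.IsBigO.trans (Asymptotics.IsBigO.of_bound 1 (.of_forall fun x => ?_))
    (h.trans (Asymptotics.IsBigO.of_bound 1 (.of_forall fun x => ?_)))
  · have hc : ‖((x 1 : ℂ) - x 0 * Complex.I)‖ = ‖((x 0 : ℂ) * Complex.I + x 1)‖ := by
      rw [← Complex.norm_conj]
      congr 1
      simp
      ring
    have hf : (raisedEisensteinTerm w n ∘ finTwoArrowEquiv ℤ) x =
        ((x 1 : ℂ) - x 0 * Complex.I) ^ n / (x 0 * Complex.I + x 1) ^ (w + n) := rfl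
    simp only [hf, norm_div, norm_pow, hc, UpperHalfPlane.coe_I, Int.cast_zero, add_zero, one_mul,
      norm_norm, norm_inv]
    rcases eq_or_ne ‖((x 0 : ℂ) * Complex.I + x 1)‖ 0 with h0 | h0
    · rw [h0, zero_pow (by omega : w + n ≠ 0)]
      simp
    · rw [pow_add, inv_pow]
      apply le_of_eq
      field_simp
  · simp

/-- The quarter turn `(c, d) ↦ (-d, c)` permutes the lattice and negates every term. -/
lemma tsum_raisedEisensteinTerm_eq_zero {w n N : ℕ} (hN : Odd N) (hw : w + 2 * n = 2 * N) :
    ∑' x, raisedEisensteinTerm w n x = 0 := by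
  let e : ℤ × ℤ ≃ ℤ × ℤ :=
    ⟨fun x => (-x.2, x.1), fun x => (x.2, -x.1), fun x => by simp, fun x => by simp⟩
  have key : ∀ x, raisedEisensteinTerm w n (e x) = -raisedEisensteinTerm w n x := by
    intro x
    have h1 : ((x.1 : ℂ) - ((-x.2 : ℤ) : ℂ) * Complex.I)
        = Complex.I * (x.2 - x.1 * Complex.I) := by
      push_cast
      linear_combination (x.1 : ℂ) * Complex.I_mul_I
    have h2 : (((-x.2 : ℤ) : ℂ) * Complex.I + x.1)
        = (-Complex.I) * (x.1 * Complex.I + x.2) := by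
      push_cast
      linear_combination (x.1 : ℂ) * Complex.I_mul_I
    -- This is `(-i)^(w+2n) = (-1)^N = -1`, where `N` odd enters.
    have h3 : Complex.I ^ n = -(-Complex.I) ^ (w + n) := by
      have h4 : Complex.I ^ n * (-Complex.I) ^ n = 1 := by
        rw [← mul_pow]; simp
      have h5 : (-Complex.I) ^ (w + n) * (-Complex.I) ^ n = -1 := by
        rw [← pow_add, show w + n + n = 2 * N by omega, pow_mul]
        simp [hN.neg_one_pow]
      have h6 : (-Complex.I) ^ n ≠ 0 := by simp
      apply mul_right_cancel₀ h6
      rw [h4, neg_mul, h5, neg_neg]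
    have h7 : (-Complex.I) ^ (w + n) ≠ 0 := by simp
    simp only [raisedEisensteinTerm, e, Equiv.coe_fn_mk]
    rw [h1, h2, mul_pow, mul_pow, h3, neg_mul, neg_div, mul_div_mul_left _ _ h7]
  have h := e.tsum_eq (raisedEisensteinTerm w n)
  simp only [key, tsum_neg] at h
  exact self_eq_neg.mp h.symm

/-- Since `w` is even, rows `c` and `-c` agree under `d ↦ -d`. -/
lemma tsum_raisedEisensteinTerm_eq {w n : ℕ} (hw : 3 ≤ w) (hw2 : Even w) :
    ∑' x, raisedEisensteinTerm w n x =
      2 * (riemannZeta w + ∑' c : ℕ+, ∑' d : ℤ, raisedEisensteinTerm w n (((c : ℕ) : ℤ), d)) := by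
  have hs := summable_raisedEisensteinTerm hw n
  rw [hs.tsum_prod, tsum_int_eq_zero_add_two_mul_tsum_pnat _ hs.prod, mul_add, nsmul_eq_mul, Nat.cast_ofNat,
    two_mul_riemannZeta_eq_tsum_int_inv_pow_of_even (by omega) hw2]
  · congr 1
    refine tsum_congr fun d => ?_
    rcases eq_or_ne d 0 with rfl | hd
    · simp [raisedEisensteinTerm, show w ≠ 0 by omega]
    · have : (d : ℂ) ≠ 0 := by exact_mod_cast hd
      simp only [raisedEisensteinTerm, Int.cast_zero, zero_mul, sub_zero, zero_add, pow_add]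
      field_simp
  · intro c
    beta_reduce
    rw [← (Equiv.neg ℤ).tsum_eq]
    refine tsum_congr fun d => ?_
    have h1 : (((-d : ℤ) : ℂ) - ((-c : ℤ) : ℂ) * Complex.I) = -(d - c * Complex.I) := by
      push_cast; ring
    have h2 : (((-c : ℤ) : ℂ) * Complex.I + ((-d : ℤ) : ℂ)) = -(c * Complex.I + d) := by
      push_cast; ring
    simp only [raisedEisensteinTerm, Equiv.neg_apply]
    rw [h1, h2, neg_pow, neg_pow (_ + _), pow_add (-1 : ℂ), hw2.neg_one_pow, one_mul,
      mul_div_mul_left _ _ (by simp)]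

/-! ### Fourier expansion of the rows -/

/-- The `m`-th Fourier coefficient of the raised Eisenstein series, without its divisor sum. -/
noncomputable def raisedFourierFactor (w n m : ℕ) : ℂ :=
  (-2 * Real.pi * Complex.I) ^ w * Complex.exp (-2 * Real.pi * m) *
    ∑ j ∈ Finset.range (n + 1),
      (n.choose j : ℂ) * ((-4 * Real.pi * m) ^ j / ((w + j - 1).factorial : ℂ))

/-- Expanding `c z̄ + d = (c z + d) - 2ci` binomially leaves pure powers `(ci + d)^(-(w+j))`, each
summed over `d` by the Lipschitz formula. -/
lemma tsum_raisedEisensteinTerm_row {w : ℕ} (hw : 2 ≤ w) (n : ℕ) (c : ℕ+) :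
    ∑' d : ℤ, raisedEisensteinTerm w n (((c : ℕ) : ℤ), d) =
      ∑' l : ℕ+, ((l : ℕ) : ℂ) ^ (w - 1) * raisedFourierFactor w n (c * l) := by
  have hc : (0 : ℝ) < (c : ℕ) := by exact_mod_cast c.pos
  let z : UpperHalfPlane := ⟨(c : ℕ) * Complex.I, by simp⟩
  have hz : (z : ℂ) = (c : ℕ) * Complex.I := rfl
  have hexp : ∀ l : ℕ, Complex.exp (2 * Real.pi * Complex.I * z) ^ l
      = Complex.exp (-2 * Real.pi * ((c : ℕ) * l : ℕ)) := by
    intro l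
    rw [← Complex.exp_nat_mul, hz]
    congr 1
    push_cast
    linear_combination (2 * l * Real.pi * (c : ℕ) : ℂ) * Complex.I_mul_I
  have hsumd : ∀ j, Summable fun d : ℤ => 1 / ((z : ℂ) + d) ^ (w + j) := by
    intro j
    have := EisensteinSeries.linear_right_summable (z : ℂ) 1 (k := ((w + j : ℕ) : ℤ)) (by omega)
    simpa only [Int.cast_one, one_mul, zpow_natCast, one_div] using this
  have hsuml : ∀ j : ℕ, Summable fun l : ℕ+ =>
      ((l : ℕ) : ℂ) ^ j * Complex.exp (2 * Real.pi * Complex.I * z) ^ (l : ℕ) := by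
    intro j
    have h := (summable_pow_mul_cexp j 1 z).comp_injective PNat.coe_injective
    simpa [Function.comp_def] using h
  have hterm : ∀ d : ℤ, raisedEisensteinTerm w n (((c : ℕ) : ℤ), d) =
      ∑ j ∈ Finset.range (n + 1),
        ((n.choose j : ℂ) * (-2 * (c : ℕ) * Complex.I) ^ j) * (1 / ((z : ℂ) + d) ^ (w + j)) := by
    intro d
    have hne : (z : ℂ) + d ≠ 0 := by
      intro h0
      have := congrArg Complex.im h0
      simp [hz] at this
    have h1 : ((d : ℂ) - (((c : ℕ) : ℤ) : ℂ) * Complex.I)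
        = (-2 * (c : ℕ) * Complex.I) + ((z : ℂ) + d) := by
      rw [hz]; push_cast; ring
    simp only [raisedEisensteinTerm]
    rw [h1, add_pow, Finset.sum_div]
    refine Finset.sum_congr rfl fun j hj => ?_
    have hj : j ≤ n := Nat.lt_succ_iff.mp (Finset.mem_range.mp hj)
    have h2 : ((((c : ℕ) : ℤ) : ℂ) * Complex.I + d) = (z : ℂ) + d := by
      rw [hz]; push_cast; ring
    rw [h2, show w + n = (w + j) + (n - j) by omega, pow_add _ (w + j)]
    field_simp
  simp_rw [hterm]
  rw [Summable.tsum_finsetSum fun j _ => (hsumd j).mul_left _]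
  have hR : ∀ l : ℕ+, ((l : ℕ) : ℂ) ^ (w - 1) * raisedFourierFactor w n (c * l) =
      ∑ j ∈ Finset.range (n + 1),
        ((n.choose j : ℂ) * (-2 * (c : ℕ) * Complex.I) ^ j *
          ((-2 * Real.pi * Complex.I) ^ (w + j) / ((w + j - 1).factorial : ℂ))) *
        (((l : ℕ) : ℂ) ^ (w + j - 1) *
          Complex.exp (2 * Real.pi * Complex.I * z) ^ (l : ℕ)) := by
    intro l
    rw [raisedFourierFactor, hexp, Finset.mul_sum, Finset.mul_sum]
    refine Finset.sum_congr rfl fun j _ => ?_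
    have h3 : (-4 * Real.pi * ((c : ℕ) * l : ℕ) : ℂ) ^ j =
        (-2 * (c : ℕ) * Complex.I) ^ j * (-2 * Real.pi * Complex.I) ^ j * ((l : ℕ) : ℂ) ^ j := by
      rw [← mul_pow, ← mul_pow]
      congr 1
      push_cast
      linear_combination (-4 * (c : ℕ) * Real.pi * (l : ℕ) : ℂ) * Complex.I_mul_I
    rw [h3, show w + j - 1 = (w - 1) + j by omega, pow_add _ w, pow_add _ (w - 1)]
    ring
  simp_rw [hR]
  rw [Summable.tsum_finsetSum fun j _ => (hsuml _).mul_left _]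
  refine Finset.sum_congr rfl fun j _ => ?_
  rw [tsum_mul_left, tsum_mul_left]
  have h := EisensteinSeries.qExpansion_identity_pnat (k := w + j - 1) (by omega) z
  rw [show w + j - 1 + 1 = w + j by omega] at h
  rw [h]
  ring

lemma summable_pow_mul_norm_raisedFourierFactor (w n p : ℕ) :
    Summable fun m : ℕ+ => ((m : ℕ) : ℝ) ^ p * ‖raisedFourierFactor w n m‖ := by
  have hq : ‖Complex.exp (-2 * Real.pi)‖ < 1 := by
    rw [Complex.norm_exp]
    simp [Real.pi_pos]
  have h : Summable fun m : ℕ => ∑ j ∈ Finset.range (n + 1),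
      (‖(-2 * Real.pi * Complex.I : ℂ)‖ ^ w * (‖(n.choose j : ℂ)‖ * (‖(-4 * Real.pi : ℂ)‖ ^ j /
        ‖((w + j - 1).factorial : ℂ)‖))) *
      ‖(m : ℂ) ^ (p + j) * Complex.exp (-2 * Real.pi) ^ m‖ :=
    summable_sum fun j _ =>
      (summable_norm_pow_mul_geometric_of_norm_lt_one (p + j) hq).mul_left _
  refine Summable.of_nonneg_of_le (fun m => by positivity) (fun m => ?_)
    (h.comp_injective PNat.coe_injective)
  simp only [raisedFourierFactor, Function.comp_apply, norm_mul, norm_pow]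
  have he : Complex.exp (-2 * Real.pi * (m : ℕ)) = Complex.exp (-2 * Real.pi) ^ (m : ℕ) := by
    rw [← Complex.exp_nat_mul]
    congr 1
    ring
  rw [he]
  calc _ ≤ ((m : ℕ) : ℝ) ^ p * ((‖(-2 : ℂ)‖ * ‖(Real.pi : ℂ)‖ * ‖Complex.I‖) ^ w *
        ‖Complex.exp (-2 * Real.pi) ^ (m : ℕ)‖ * ∑ j ∈ Finset.range (n + 1),
        ‖(n.choose j : ℂ) * ((-4 * Real.pi * (m : ℕ)) ^ j / ((w + j - 1).factorial : ℂ))‖) := by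
        gcongr
        exact norm_sum_le _ _
    _ = _ := by
        simp only [Finset.mul_sum, norm_mul, norm_div, norm_pow, Complex.norm_natCast]
        refine Finset.sum_congr rfl fun j _ => ?_
        ring

lemma hasSum_raisedFourierFactor {w n N : ℕ} (hw : 3 ≤ w) (hN : Odd N)
    (hwn : w + 2 * n = 2 * N) :
    HasSum (fun m : ℕ+ =>
      (∑ d ∈ (m : ℕ).divisors, (d : ℂ) ^ (w - 1)) * raisedFourierFactor w n m)
      (-riemannZeta w) := by
  have h := tsum_raisedEisensteinTerm_eq (n := n) hw ⟨N - n, by omega⟩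
  rw [tsum_raisedEisensteinTerm_eq_zero hN hwn, tsum_congr
    (fun c => tsum_raisedEisensteinTerm_row (by omega) n c)] at h
  have h2 := hasSum_sum_divisors_pow_mul (w - 1)
    (summable_pow_mul_norm_raisedFourierFactor w n (w - 1 + 1))
  convert h2 using 1
  linear_combination h / 2

/-! ### Matching the stated series -/

lemma divisorPowerSum_one_sub {w m : ℕ} (hw : 1 ≤ w) (hm : m ≠ 0) :
    divisorPowerSum (1 - (w : ℂ)) m * (m : ℂ) ^ (w - 1) =
      ∑ d ∈ m.divisors, (d : ℂ) ^ (w - 1) := by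
  rw [divisorPowerSum, Finset.sum_mul, ← Nat.sum_div_divisors]
  refine Finset.sum_congr rfl fun d hd => ?_
  have hd0 : (d : ℂ) ≠ 0 := by
    exact_mod_cast (Nat.pos_of_mem_divisors hd).ne'
  rw [show (1 - (w : ℂ)) = -((w - 1 : ℕ) : ℂ) by push_cast [hw]; ring, Complex.cpow_neg,
    Complex.cpow_natCast, Nat.cast_div (Nat.dvd_of_mem_divisors hd) hd0, div_pow]
  field_simp

lemma pi_pow_mul_zetaSeriesTerm (h n m : ℕ) (h1 : 1 ≤ h) (hm : m ≠ 0) (k : ℕ)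
    (hk : k / 2 = h + n) :
    (Real.pi : ℂ) ^ h * zetaSeriesTerm h k m =
      (∑ d ∈ m.divisors, (d : ℂ) ^ (2 * h - 1)) * raisedFourierFactor (2 * h) n m := by
  have hsum : (∑ r ∈ Finset.Icc (1 - (h : ℤ)) ((k / 2 : ℕ) : ℤ),
        (-1 : ℂ) ^ r * (Nat.choose (k / 2 - h) (((k / 2 : ℕ) : ℤ) - r).toNat : ℂ)
          * ((4 * (Real.pi : ℂ) * (m : ℂ)) ^ r / (Nat.factorial ((h : ℤ) - 1 + r).toNat : ℂ)))
      = (-4 * Real.pi * m : ℂ) ^ h * ∑ j ∈ Finset.range (n + 1),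
      (n.choose j : ℂ) * ((-4 * Real.pi * m) ^ j / ((2 * h + j - 1).factorial : ℂ)) := by
    rw [Finset.mul_sum, hk, Nat.add_sub_cancel_left]
    symm
    refine Finset.sum_of_injOn (fun j : ℕ => (h : ℤ) + j) (fun a _ b _ hab => by simpa using hab)
      (fun j hj => ?_) (fun r hr hr' => ?_) (fun j hj => ?_)
    · simp only [Finset.coe_range, Set.mem_Iio] at hj
      simp only [Finset.coe_Icc, Set.mem_Icc]
      omega
    · rw [Finset.mem_Icc] at hr
      -- For `r < h` the lower binomial index exceeds `n`, so only `r = h + j` with `0 ≤ j ≤ n`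
      -- survives.
      have hlt : r < h := by
        by_contra! hge
        refine hr' ⟨(r - h).toNat, ?_, ?_⟩
        · simp only [Finset.coe_range, Set.mem_Iio]
          omega
        · simp only
          omega
      rw [Nat.choose_eq_zero_of_lt (by omega)]
      simp
    · have hj : j ≤ n := Nat.lt_succ_iff.mp (Finset.mem_range.mp hj)
      rw [show (((h + n : ℕ) : ℤ) - (h + j)).toNat = n - j by omega, Nat.choose_symm hj,
        show ((h : ℤ) - 1 + (h + j)).toNat = 2 * h + j - 1 by omega,
        show ((h : ℤ) + j) = ((h + j : ℕ) : ℤ) by push_cast; ring, zpow_natCast, zpow_natCast,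
        show (-4 * Real.pi * m : ℂ) = -(4 * Real.pi * m) by ring, pow_add, pow_add,
        neg_pow (4 * Real.pi * m : ℂ) h, neg_pow (4 * Real.pi * m : ℂ) j]
      ring
  rw [zetaSeriesTerm, hsum, raisedFourierFactor, ← divisorPowerSum_one_sub (by omega) hm]
  have hz : (m : ℂ) ^ (1 - (h : ℤ)) = ((m : ℂ) ^ (h - 1))⁻¹ := by
    rw [show (1 - (h : ℤ)) = -((h - 1 : ℕ) : ℤ) by omega, zpow_neg, zpow_natCast]
  have hp : (-2 * Real.pi * Complex.I : ℂ) ^ (2 * h) = Real.pi ^ h * (-4 * Real.pi) ^ h := by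
    rw [pow_mul, ← mul_pow]
    congr 1
    linear_combination (4 * Real.pi ^ 2 : ℂ) * Complex.I_sq
  rw [hz, hp, div_inv_eq_mul, show 2 * h - 1 = h - 1 + h by omega, pow_add, mul_pow _ (m : ℂ)]
  push_cast
  ring

/-- For positive integers `h`, `k` with `k ≡ 2 (mod 4)` and `2 ≤ h ≤ k/2`, the series below
converges absolutely and gives the value of the Riemann zeta function at `2h`. -/
theorem proposition7p1 (h k : ℕ) (hk : k ≡ 2 [MOD 4]) (h2 : 2 ≤ h) (hhk : h ≤ k / 2) :
    Summable (fun m : ℕ+ => zetaSeriesTerm h k m) ∧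
      riemannZeta (2 * (h : ℂ)) =
        -(Real.pi : ℂ) ^ h * ∑' m : ℕ+, zetaSeriesTerm h k m := by
  have hpi : (Real.pi : ℂ) ^ h ≠ 0 := pow_ne_zero _ (by exact_mod_cast Real.pi_ne_zero)
  obtain ⟨n, hn⟩ := Nat.exists_eq_add_of_le hhk
  have hodd : Odd (k / 2) := by
    rw [Nat.odd_iff]
    have : k % 4 = 2 := hk
    omega
  have key := hasSum_raisedFourierFactor (w := 2 * h) (n := n) (by omega) hodd
    (by omega)
  simp_rw [← pi_pow_mul_zetaSeriesTerm h n _ (by omega) (PNat.ne_zero _) k hn] at key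
  refine ⟨(summable_mul_left_iff hpi).mp key.summable, ?_⟩
  have h3 := key.tsum_eq
  rw [tsum_mul_left] at h3
  push_cast at h3
  rw [neg_mul, h3, neg_neg]
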